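/- Let $L$ be a (possibly multi-sorted) first-order language with equality, $T$ a complete (i.e. maximal satisfiable) $L$-theory, and $x$ a finite tuple of variables. For a model $M\models T$ let $L_x(M)$ be the Boolean algebra of subsets of $M_x$ (the set of $x$-indexed tuples of $M$) that are definable in $M$ with parameters. A $\bigvee$-definable ideal schema $I$ for $T$ in context $x$ assigns to every partitioned formula $\psi(x,y)$, $y$ a finite tuple of variables disjoint from $x$, a set $\neg I x.\psi(x,y)$ of $L$-formulas in the variables $y$ such that for every $M\models T$: (1) whether $c\in M_y$ satisfies all formulas of $\neg I x.\psi(x,y)$ in $M$ depends only on the set $\psi(M,c)\in L_x(M)$; and (2) the collection $I(M)$ of all $\psi(M,c)\in L_x(M)$ for which $c$ does not satisfy all formulas of $\neg I x.\psi(x,y)$ is a proper ideal of $L_x(M)$. Let $I$ be such a schema and $\phi(x,y)$ a partitioned formula ($x$, $y$ finite tuples). For $M\models T$ and $D\in L_x(M)$ put $R^{I(M)}(D,\phi,2)\ge 0$ iff $D\notin I(M)$, and $R^{I(M)}(D,\phi,2)\ge k+1$ iff there is $c\in M_y$ such that $R^{I(M)}(D\cap\phi(M,c),\phi,2)\ge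 k$ and $R^{I(M)}(D\setminus\phi(M,c),\phi,2)\ge k$; let $R^{I(M)}(D,\phi,2)\in\{-\infty\}\cup\mathbb{N}\cup\{+\infty\}$ be the supremum of all $k\in\mathbb{N}$ with $R^{I(M)}(D,\phi,2)\ge k$ ($-\infty$ if there is none). The formula $\phi$ is $I$-stable (in $T$) if $R^{I(M)}(M_x,\phi,2)<+\infty$ for every $M\models T$. For $a\in M_x$ and a set $B$ of elements of $M$, let $L_\phi(B,M)$ be the subalgebra of $L_x(M)$ generated by the sets $\phi(M,c)$ with $c$ a $y$-tuple of elements of $B$, and let $\mathrm{tp}_\phi(a/B)=\{D\in L_\phi(B,M): a\in D\}$; it is $I$-wide if it contains no element of $I(M)$. The formula $\phi$ has the wide order property (in $T$, with respect to $I$) if there are a model $M\models T$ and sequences $(a_i)_{i\in\omega}$ in $M_x$ and $(b_j)_{j\in\omega}$ in $M_y$ such that, for all $i,j\in\omega$, $M\models\phi(a_i,b_j)$ if and only if $i<j$, and, for every $i\in\omega$, $\mathrm{tp}_\phi(a_i/\bar b)$ is $I$-wide, where $\bar b$ is the set of all elements occurring in the tuples $b_j$, $j\in\omega$. Theorem.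 $\phi$ is $I$-stable if and only if $\phi$ does not have the wide order property with respect to $I$. -/

import Mathlib

universe u v

namespace WideStability

/-- A (possibly multi-sorted) first-order signature: a set of sorts, sorted function symbols
(constants are the function symbols of arity `0`) and sorted relation symbols. Equality is a
logical symbol. Sorts, symbols and the domains of structures are sets, i.e. live in `Type u`. -/
structure Signature where
  /-- the sorts -/
  Srt : Type u
  /-- the function symbols -/
  Fn : Type u
  fnArity : Fn → ℕ
  fnDom : (f : Fn) → Fin (fnArity f) → Srt
  fnCod : Fn → Srt
  /-- the relation symbols -/
  Rl : Type u
  rlArity : Rl → ℕ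
  rlDom : (R : Rl) → Fin (rlArity R) → Srt

variable {σ : Signature.{u}}

/-- Terms whose variables are indexed by `V`, the variable `i` being of sort `x i`; the last
index is the sort of the term. -/
inductive Term (σ : Signature.{u}) {V : Type v} (x : V → σ.Srt) : σ.Srt → Type (max u v)
  | var (i : V) : Term σ x (x i)
  | app (f : σ.Fn) (ts : (i : Fin (σ.fnArity f)) → Term σ x (σ.fnDom f i)) :
      Term σ x (σ.fnCod f)

/-- First-order formulas with free variables indexed by `V` (the variable `i` being of sort `x i`)
and further (de Bruijn) variables whose sorts are listed by `Γ`, the head of the list being the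
variable bound last. -/
inductive BForm (σ : Signature.{u}) {V : Type v} (x : V → σ.Srt) :
    List σ.Srt → Type (max u v)
  | falsum {Γ : List σ.Srt} : BForm σ x Γ
  | eq {Γ : List σ.Srt} {s : σ.Srt} (t₁ t₂ : Term σ (Sum.elim x Γ.get) s) : BForm σ x Γ
  | rel {Γ : List σ.Srt} (R : σ.Rl)
      (ts : (i : Fin (σ.rlArity R)) → Term σ (Sum.elim x Γ.get) (σ.rlDom R i)) : BForm σ x Γ
  | imp {Γ : List σ.Srt} (φ ψ : BForm σ x Γ) : BForm σ x Γ
  | all {Γ : List σ.Srt} (s : σ.Srt) (φ : BForm σ x (s :: Γ)) : BForm σ x Γ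

/-- Formulas all of whose free variables are among the tuple `x` of sorted variables. -/
abbrev Form (σ : Signature.{u}) {V : Type v} (x : V → σ.Srt) : Type (max u v) :=
  BForm σ x []

/-- Partitioned formulas `φ(x, y)` in the context `x` and the parameters `y`. -/
abbrev PForm (σ : Signature.{u}) {n m : ℕ} (x : Fin n → σ.Srt) (y : Fin m → σ.Srt) : Type u :=
  Form σ (Sum.elim x y)

/-- Sentences: formulas without free variables. -/
abbrev Sentence (σ : Signature.{u}) : Type u :=
  Form σ (fun e : Empty => (e.elim : σ.Srt))

/-- `σ`-structures. -/
structure Str (σ : Signature.{u}) where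
  carrier : σ.Srt → Type u
  fn : (f : σ.Fn) → ((i : Fin (σ.fnArity f)) → carrier (σ.fnDom f i)) → carrier (σ.fnCod f)
  rl : (R : σ.Rl) → ((i : Fin (σ.rlArity R)) → carrier (σ.rlDom R i)) → Prop

/-- `M_x`: the `x`-indexed tuples of elements of `M`, of the sorts prescribed by `x`. -/
abbrev Str.Tup (M : Str σ) {V : Type v} (x : V → σ.Srt) : Type (max u v) :=
  (i : V) → M.carrier (x i)

variable {M : Str σ}

/-- Concatenation of tuples. -/
def Str.Tup.append {V W : Type v} {x : V → σ.Srt} {y : W → σ.Srt}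
    (a : M.Tup x) (c : M.Tup y) : M.Tup (Sum.elim x y)
  | .inl i => a i
  | .inr j => c j

/-- Values of the free variables together with values of the de Bruijn variables. -/
def Str.Tup.env {V : Type v} {x : V → σ.Srt} {Γ : List σ.Srt}
    (a : M.Tup x) (e : M.Tup Γ.get) : M.Tup (Sum.elim x Γ.get)
  | .inl i => a i
  | .inr j => e j

/-- A new value in front of the values of the de Bruijn variables. -/
def Str.Tup.cons {s : σ.Srt} {Γ : List σ.Srt} (d : M.carrier s) (e : M.Tup Γ.get) :
    M.Tup (s :: Γ).get
  | ⟨0, _⟩ => d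
  | ⟨i + 1, h⟩ => e ⟨i, Nat.lt_of_succ_lt_succ h⟩

/-- The value of a term. -/
def Term.eval {V : Type v} {x : V → σ.Srt} (a : M.Tup x) :
    {s : σ.Srt} → Term σ x s → M.carrier s
  | _, .var i => a i
  | _, .app f ts => M.fn f fun i => (ts i).eval a

/-- Satisfaction of a formula. -/
def BForm.Holds {V : Type v} {x : V → σ.Srt} (a : M.Tup x) :
    {Γ : List σ.Srt} → BForm σ x Γ → M.Tup Γ.get → Prop
  | _, .falsum, _ => False
  | _, .eq t₁ t₂, e => t₁.eval (a.env e) = t₂.eval (a.env e)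
  | _, .rel R ts, e => M.rl R fun i => (ts i).eval (a.env e)
  | _, .imp φ ψ, e => φ.Holds a e → ψ.Holds a e
  | _, .all s φ, e => ∀ d : M.carrier s, φ.Holds a (Str.Tup.cons d e)

/-- `M ⊨ φ(a)`. -/
def Form.Sat {V : Type v} {x : V → σ.Srt} (φ : Form σ x) (a : M.Tup x) : Prop :=
  φ.Holds a (fun i => i.elim0)

/-- `M ⊨ T`. -/
def Str.IsModel (M : Str σ) (T : Set (Sentence σ)) : Prop :=
  ∀ φ ∈ T, Form.Sat (M := M) φ (fun e => e.elim)

/-- `T` has a model. -/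
def Satisfiable (T : Set (Sentence σ)) : Prop :=
  ∃ M : Str σ, M.IsModel T

/-- `T` is a complete theory, i.e. maximal satisfiable. -/
def IsCompleteTheory (T : Set (Sentence σ)) : Prop :=
  Maximal Satisfiable T

/-- The set `ψ(M, c) ⊆ M_x` defined in `M` by the instance `ψ(x, c)` of `ψ(x, y)`. -/
def PForm.points {n m : ℕ} {x : Fin n → σ.Srt} {y : Fin m → σ.Srt}
    (ψ : PForm σ x y) (c : M.Tup y) : Set (M.Tup x) :=
  {a | Form.Sat ψ (a.append c)}

/-- The subsets of `M_x` that are definable in `M` with parameters. They form the Boolean algebra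
`L_x(M)`, the class of `ψ(x, c)` modulo equivalence in `M` being identified with `ψ(M, c)`. -/
def Str.definableSets (M : Str σ) {n : ℕ} (x : Fin n → σ.Srt) : Set (Set (M.Tup x)) :=
  {D | ∃ (m : ℕ) (y : Fin m → σ.Srt) (ψ : PForm σ x y) (c : M.Tup y), D = ψ.points c}

/-- `J` is a (proper) ideal of the Boolean algebra `L_x(M)`. -/
structure Str.IsIdeal (M : Str σ) {n : ℕ} {x : Fin n → σ.Srt} (J : Set (Set (M.Tup x))) :
    Prop where
  subset : J ⊆ M.definableSets x
  bot_mem : ∅ ∈ J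
  top_notMem : Set.univ ∉ J
  sup_mem : ∀ D ∈ J, ∀ E ∈ J, D ∪ E ∈ J
  down : ∀ D ∈ J, ∀ E ∈ M.definableSets x, E ⊆ D → E ∈ J

/-- A `⋁`-preschema of partial types on `L_x`: it assigns to every partitioned formula `ψ(x, y)` in
the context `x`, with any finite tuple `y` of parameter variables, a set `¬I x. ψ(x, y)` of
formulas in the variables `y`. -/
abbrev Preschema {n : ℕ} (x : Fin n → σ.Srt) : Type u :=
  ∀ (m : ℕ) (y : Fin m → σ.Srt), PForm σ x y → Set (Form σ y)

namespace Preschema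

variable {n : ℕ} {x : Fin n → σ.Srt}

/-- `M ⊨ ¬I x. ψ(x, c)`. -/
def SaysWide (I : Preschema x) {m : ℕ} {y : Fin m → σ.Srt} (ψ : PForm σ x y) (c : M.Tup y) :
    Prop :=
  ∀ θ ∈ I m y ψ, Form.Sat θ c

/-- Whether `M ⊨ ¬I x. ψ(x, c)` holds depends only on the set that `ψ(x, c)` defines in `M`. -/
def IsInvariant (I : Preschema x) (M : Str σ) : Prop :=
  ∀ {m k : ℕ} {y : Fin m → σ.Srt} {z : Fin k → σ.Srt} (ψ : PForm σ x y) (θ : PForm σ x z)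
    (c : M.Tup y) (d : M.Tup z), ψ.points c = θ.points d →
      (SaysWide I ψ c ↔ SaysWide I θ d)

/-- `I(M)`: the set of those definable sets `ψ(M, c)` for which `M ⊭ ¬I x. ψ(x, c)`. -/
def points (I : Preschema x) (M : Str σ) : Set (Set (M.Tup x)) :=
  {D | ∃ (m : ℕ) (y : Fin m → σ.Srt) (ψ : PForm σ x y) (c : M.Tup y),
    D = ψ.points c ∧ ¬ SaysWide I ψ c}

/-- `I` is a `⋁`-definable ideal schema for `T`: it `⋁`-defines an ideal of `L_x(M)` for every
model `M` of `T`. -/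
def IsIdealSchema (I : Preschema x) (T : Set (Sentence σ)) : Prop :=
  ∀ M : Str σ, M.IsModel T → IsInvariant I M ∧ M.IsIdeal (points I M)

end Preschema

section Rank

variable {n m : ℕ} {x : Fin n → σ.Srt} {y : Fin m → σ.Srt}

/-- The relation `R^J(D, φ, 2) ≥ k` for a definable set `D ∈ L_x(M)` and an ideal `J` of
`L_x(M)`. -/
def RankGE (J : Set (Set (M.Tup x))) (φ : PForm σ x y) : ℕ → Set (M.Tup x) → Prop
  | 0, D => D ∉ J
  | k + 1, D => ∃ c : M.Tup y, RankGE J φ k (D ∩ φ.points c) ∧ RankGE J φ k (D ∩ (φ.points c)ᶜ)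

/-- The rank `R^J(D, φ, 2)`, with values in `ℕ ∪ {-∞, +∞}`: the supremum of all `k` such that
`R^J(D, φ, 2) ≥ k`; it is `-∞ = ⊥` if there is no such `k`. -/
noncomputable def rank (J : Set (Set (M.Tup x))) (φ : PForm σ x y) (D : Set (M.Tup x)) :
    WithBot ℕ∞ :=
  sSup {r : WithBot ℕ∞ | ∃ k : ℕ, RankGE J φ k D ∧ r = ((k : ℕ∞) : WithBot ℕ∞)}

/-- `φ` is `I`-stable in `M`: `R^{I(M)}(x = x, φ, 2) < ∞`. -/
def IsStableIn (M : Str σ) (I : Preschema x) (φ : PForm σ x y) : Prop :=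
  rank (Preschema.points I M) φ Set.univ < ⊤

/-- `φ` is `I`-stable in `T`: it is `I`-stable in every model of `T`. -/
def IsStable (T : Set (Sentence σ)) (I : Preschema x) (φ : PForm σ x y) : Prop :=
  ∀ M : Str σ, M.IsModel T → IsStableIn M I φ

end Rank

section Order

variable {n m : ℕ} {x : Fin n → σ.Srt} {y : Fin m → σ.Srt}

/-- `L_φ(B, M)`: the subalgebra of `L_x(M)` generated by the sets `φ(M, c)`, where `c` is a tuple
of elements of the set `B` of parameters. -/
def localAlgebra (φ : PForm σ x y) (B : Set (Σ s, M.carrier s)) :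
    BooleanSubalgebra (Set (M.Tup x)) :=
  BooleanSubalgebra.closure {D | ∃ c : M.Tup y, (∀ k, ⟨y k, c k⟩ ∈ B) ∧ D = φ.points c}

/-- The complete `φ`-type `tp_φ(a / B)`, as an ultrafilter on `L_φ(B, M)`. -/
def localType (φ : PForm σ x y) (a : M.Tup x) (B : Set (Σ s, M.carrier s)) :
    Set (Set (M.Tup x)) :=
  {D | D ∈ localAlgebra φ B ∧ a ∈ D}

/-- A type is wide with respect to the ideal `J` if it contains no element of `J`. -/
def IsWide (J p : Set (Set (M.Tup x))) : Prop :=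
  p ∩ J = ∅

/-- The set of all elements that occur in the tuples `b 0, b 1, …`. -/
def paramSet (b : ℕ → M.Tup y) : Set (Σ s, M.carrier s) :=
  {e | ∃ (j : ℕ) (k : Fin m), e = ⟨y k, b j k⟩}

/-- `M` realizes an infinite wide `φ`-order with respect to `I`. -/
def RealizesWideOrder (M : Str σ) (I : Preschema x) (φ : PForm σ x y) : Prop :=
  ∃ (a : ℕ → M.Tup x) (b : ℕ → M.Tup y),
    (∀ i j : ℕ, Form.Sat φ ((a i).append (b j)) ↔ i < j) ∧
    ∀ i : ℕ, IsWide (Preschema.points I M) (localType φ (a i) (paramSet b))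

/-- `φ` has the wide order property in `T` with respect to `I`: some model of `T` realizes an
infinite wide `φ`-order. -/
def HasWideOrderProperty (T : Set (Sentence σ)) (I : Preschema x) (φ : PForm σ x y) : Prop :=
  ∃ M : Str σ, M.IsModel T ∧ RealizesWideOrder M I φ

end Order

end WideStability

/-! If a model contains a wide order, bisecting a ladder of `2 ^ k` wide elements `a i` by `φ(x, b
j)` at its midpoint gives a binary tree of definable sets of height `k`. Each leaf lies in the local
algebra and contains some `a i`, so wideness keeps it outside the ideal (`rankGE_of_ladder`). Hence
the rank is infinite.

Conversely, let the rank be infinite in `M`. A rank tree has finitely many parameters; let `F` be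
the set of their entries. Each leaf, being outside the ideal, shrinks to a definable set outside the
ideal that decides every `φ(x, c)` with `c` from `F`, and every point of the smaller set is then
wide over `F` (`RankGE.exists_hasTree`). So there are arbitrarily high trees with wide points as
leaves, and a Ramsey argument extracts half graphs of every finite length from them
(`HasTree.exists_halfGraph`). An ultraproduct of these finite orders is an infinite order in an
ultrapower of `M`. It is still wide: being outside the ideal is expressed by a set of formulas on
the parameters, so it passes to the ultrapower by Łoś (`isWide_ultra`). -/

namespace WideStability

/-! ### Trees and half graphs -/

/-- The set `S` carries a complete binary tree of height `k`, whose nodes are labelled by elements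
of `P` and whose leaves are elements of `S` branching according to `R`. -/
def HasTree {A B : Type*} (R : A → B → Prop) (P : Set B) : ℕ → Set A → Prop
  | 0, S => S.Nonempty
  | k + 1, S => ∃ b ∈ P, HasTree R P k (S ∩ {a | R a b}) ∧ HasTree R P k (S ∩ {a | R a b}ᶜ)

namespace HasTree

variable {A B : Type*} {R : A → B → Prop} {P Q : Set B} {S S' : Set A}

lemma mono {k : ℕ} (hPQ : P ⊆ Q) (hS : S ⊆ S') (h : HasTree R P k S) : HasTree R Q k S' := by
  induction k generalizing S S' with
  | zero => exact Set.Nonempty.mono hS h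
  | succ k ih =>
    obtain ⟨b, hb, h₁, h₂⟩ := h
    exact ⟨b, hPQ hb, ih (Set.inter_subset_inter_left _ hS) h₁,
      ih (Set.inter_subset_inter_left _ hS) h₂⟩

lemma of_succ {k : ℕ} (h : HasTree R P (k + 1) S) : HasTree R P k S := by
  obtain ⟨b, -, h, -⟩ := h
  exact h.mono subset_rfl Set.inter_subset_left

lemma of_le {k l : ℕ} (hkl : k ≤ l) (h : HasTree R P l S) : HasTree R P k S := by
  induction l, hkl using Nat.le_induction with
  | base => exact h
  | succ l _ ih => exact ih h.of_succ

lemma nonempty {k : ℕ} (h : HasTree R P k S) : S.Nonempty :=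
  h.of_le (Nat.zero_le k)

/-- The Ramsey property of binary trees. -/
lemma of_union {N k l : ℕ} (hN : k + l ≤ N) (h : HasTree R (P ∪ Q) N S) :
    HasTree R P k S ∨ HasTree R Q l S := by
  induction N generalizing k l S with
  | zero =>
    obtain rfl : k = 0 := by omega
    exact .inl h
  | succ N ih =>
    rcases k with _ | k
    · exact .inl h.nonempty
    rcases l with _ | l
    · exact .inr h.nonempty
    -- If the root label is in `P`, either both halves carry `P`-trees of height `k`, which the root
    -- joins, or one half already carries the `Q`-tree; symmetrically for `Q`.
    obtain ⟨b, hb | hb, h₁, h₂⟩ := h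
    · rcases ih (k := k) (l := l + 1) (by omega) h₁ with h₁ | h₁
      · rcases ih (k := k) (l := l + 1) (by omega) h₂ with h₂ | h₂
        · exact .inl ⟨b, hb, h₁, h₂⟩
        · exact .inr (h₂.mono subset_rfl Set.inter_subset_left)
      · exact .inr (h₁.mono subset_rfl Set.inter_subset_left)
    · rcases ih (k := k + 1) (l := l) (by omega) h₁ with h₁ | h₁
      · exact .inl (h₁.mono subset_rfl Set.inter_subset_left)
      · rcases ih (k := k + 1) (l := l) (by omega) h₂ with h₂ | h₂
        · exact .inl (h₂.mono subset_rfl Set.inter_subset_left)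
        · exact .inr ⟨b, hb, h₁, h₂⟩

/-- A sufficiently high binary tree contains a half graph of length `n` off the diagonal. -/
lemma exists_offDiagonal (R : A → B → Prop) (n : ℕ) : ∃ k, ∀ (P : Set B) (S : Set A),
    HasTree R P k S → ∃ (a : ℕ → A) (b : ℕ → B), (∀ i, a i ∈ S) ∧ (∀ j, b j ∈ P) ∧
      ∀ i < n, ∀ j < n, (i < j → R (a i) (b j)) ∧ (j < i → ¬ R (a i) (b j)) := by
  induction n with
  | zero =>
    -- Height `1`, not `0`: a label in `P` is needed as the default value of `b`.
    refine ⟨1, fun P S h => ?_⟩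
    obtain ⟨a, ha⟩ := h.nonempty
    obtain ⟨b, hb, -⟩ := h
    exact ⟨fun _ => a, fun _ => b, fun _ => ha, fun _ => hb, by simp⟩
  | succ n ih =>
    obtain ⟨k, ih⟩ := ih
    refine ⟨(k + 1) + (k + 1), fun P S h => ?_⟩
    obtain ⟨a, ha⟩ := h.nonempty
    -- Colour the labels by their relation to one fixed `a`. If all labels of a subtree satisfy `R a
    -- b`, pass to the negative side of its root `b₀` and put `a`, `b₀` in front of the order;
    -- otherwise pass to the positive side and put them at the end.
    have hP : P = (P ∩ {b | R a b}) ∪ (P ∩ {b | R a b}ᶜ) := (Set.inter_union_compl P _).symm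
    rw [hP] at h
    rcases h.of_union le_rfl with ⟨b₀, hb₀, -, h⟩ | ⟨b₀, hb₀, h, -⟩
    · obtain ⟨a', b', ha', hb', hab⟩ := ih _ _ h
      refine ⟨fun i => Nat.casesOn i a a', fun j => Nat.casesOn j b₀ b', ?_, ?_, ?_⟩
      · rintro (_ | i)
        exacts [ha, (ha' i).1]
      · rintro (_ | j)
        exacts [hb₀.1, (hb' j).1]
      · rintro (_ | i) hi (_ | j) hj
        · simp
        · exact ⟨fun _ => (hb' j).2, fun h => absurd h (Nat.not_lt_zero _)⟩
        · exact ⟨fun h => absurd h (Nat.not_lt_zero _), fun _ => (ha' i).2⟩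
        · simpa using hab i (by omega) j (by omega)
    · obtain ⟨a', b', ha', hb', hab⟩ := ih _ _ h
      refine ⟨fun i => if i < n then a' i else a, fun j => if j < n then b' j else b₀, ?_, ?_, ?_⟩
      · intro i
        dsimp only
        split_ifs
        exacts [(ha' i).1, ha]
      · intro j
        dsimp only
        split_ifs
        exacts [(hb' j).1, hb₀.1]
      · intro i hi j hj
        dsimp only
        split_ifs with h₁ h₂ h₂
        · exact hab i h₁ j h₂
        · exact ⟨fun _ => (ha' i).2, fun h => by omega⟩
        · exact ⟨fun h => by omega, fun _ => (hb' j).2⟩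
        · exact ⟨fun h => by omega, fun h => by omega⟩

/-- A sufficiently high binary tree contains a half graph of length `n`. -/
lemma exists_halfGraph (R : A → B → Prop) (n : ℕ) : ∃ k, ∀ (P : Set B) (S : Set A),
    HasTree R P k S → ∃ (a : ℕ → A) (b : ℕ → B), (∀ i, a i ∈ S) ∧ (∀ j, b j ∈ P) ∧
      ∀ i < n, ∀ j < n, R (a i) (b j) ↔ i < j := by
  obtain ⟨k, hk⟩ := exists_offDiagonal R (2 * n)
  refine ⟨k, fun P S h => ?_⟩
  obtain ⟨a, b, ha, hb, hab⟩ := hk P S h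
  -- Odd indices never equal even ones, so the uncontrolled diagonal is avoided, and `2 * i + 1 < 2
  -- * j` is equivalent to `i < j`.
  refine ⟨fun i => a (2 * i + 1), fun j => b (2 * j), fun i => ha _, fun j => hb _, ?_⟩
  intro i hi j hj
  have := hab (2 * i + 1) (by omega) (2 * j) (by omega)
  exact ⟨fun h => by_contra fun hij => this.2 (by omega) h, fun h => this.1 (by omega)⟩

end HasTree

/-! ### Substitution -/

variable {σ : Signature.{u}} {M : Str σ}

/-- Simultaneous substitution of terms for the variables of a term. -/
def Term.subst {V W : Type v} {x : V → σ.Srt} {z : W → σ.Srt} (f : ∀ i, Term σ z (x i)) :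
    {s : σ.Srt} → Term σ x s → Term σ z s
  | _, .var i => f i
  | _, .app g ts => .app g fun i => (ts i).subst f

lemma Term.eval_subst {V W : Type v} {x : V → σ.Srt} {z : W → σ.Srt}
    (f : ∀ i, Term σ z (x i)) (a : M.Tup z) {s : σ.Srt} (t : Term σ x s) :
    (t.subst f).eval a = t.eval (fun i => (f i).eval a) := by
  induction t with
  | var i => rfl
  | app g ts ih => simp only [Term.subst, Term.eval, ih]

/-- The extension of a substitution for the free variables that leaves the de Bruijn variables in
place. -/
def Term.liftSubst {V W : Type} {x : V → σ.Srt} {z : W → σ.Srt} (f : ∀ i, Term σ z (x i))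
    (Γ : List σ.Srt) : ∀ i, Term σ (Sum.elim z Γ.get) (Sum.elim x Γ.get i)
  | .inl i => (f i).subst fun j => .var (x := Sum.elim z Γ.get) (.inl j)
  | .inr j => .var (x := Sum.elim z Γ.get) (.inr j)

/-- Simultaneous substitution of terms for the free variables of a formula. -/
def BForm.subst {V W : Type} {x : V → σ.Srt} {z : W → σ.Srt} (f : ∀ i, Term σ z (x i)) :
    {Γ : List σ.Srt} → BForm σ x Γ → BForm σ z Γ
  | _, .falsum => .falsum
  | _, .eq t₁ t₂ => .eq (t₁.subst (Term.liftSubst f _)) (t₂.subst (Term.liftSubst f _))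
  | _, .rel R ts => .rel R fun i => (ts i).subst (Term.liftSubst f _)
  | _, .imp φ ψ => .imp (φ.subst f) (ψ.subst f)
  | _, .all s φ => .all s (φ.subst f)

lemma Term.eval_subst_liftSubst {V W : Type} {x : V → σ.Srt} {z : W → σ.Srt}
    (f : ∀ i, Term σ z (x i)) (a : M.Tup z) {Γ : List σ.Srt} (e : M.Tup Γ.get) {s : σ.Srt}
    (t : Term σ (Sum.elim x Γ.get) s) :
    (t.subst (Term.liftSubst f Γ)).eval (a.env e) =
      t.eval (Str.Tup.env (fun i => (f i).eval a) e) := by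
  rw [Term.eval_subst]
  congr 1
  funext i
  rcases i with i | j
  · exact Term.eval_subst _ _ _
  · rfl

/-- No capture can occur: the substituted terms contain no de Bruijn variables. This is needed to
form disjunctions with separate parameter tuples. -/
lemma BForm.holds_subst {V W : Type} {x : V → σ.Srt} {z : W → σ.Srt}
    (f : ∀ i, Term σ z (x i)) (a : M.Tup z) {Γ : List σ.Srt} (φ : BForm σ x Γ)
    (e : M.Tup Γ.get) :
    (φ.subst f).Holds a e ↔ φ.Holds (fun i => (f i).eval a) e := by
  induction φ with
  | falsum => rfl
  | eq t₁ t₂ => simp only [BForm.subst, BForm.Holds, Term.eval_subst_liftSubst]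
  | rel R ts => simp only [BForm.subst, BForm.Holds, Term.eval_subst_liftSubst]
  | imp φ ψ ih₁ ih₂ => simp only [BForm.subst, BForm.Holds, ih₁, ih₂]
  | all s φ ih => simp only [BForm.subst, BForm.Holds, ih]

/-- A variable, regarded as a term of a sort equal to that of the variable. -/
def Term.varOfEq {V : Type v} {x : V → σ.Srt} (i : V) {s : σ.Srt} (h : x i = s) : Term σ x s :=
  h ▸ .var i

lemma Term.eval_varOfEq {V : Type v} {x : V → σ.Srt} (a : M.Tup x) (i : V) {s : σ.Srt}
    (h : x i = s) : (Term.varOfEq i h).eval a = h ▸ a i := by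
  subst h; rfl

/-! ### Boolean operations on partitioned formulas -/

/-- The concatenation of the sorts of two finite tuples of parameter variables. -/
def joinSrt {k l : ℕ} (y : Fin k → σ.Srt) (z : Fin l → σ.Srt) : Fin (k + l) → σ.Srt :=
  fun i => Sum.elim y z (finSumFinEquiv.symm i)

/-- The concatenation of two finite tuples of parameters. -/
def Str.Tup.join {k l : ℕ} {y : Fin k → σ.Srt} {z : Fin l → σ.Srt} (c : M.Tup y) (d : M.Tup z) :
    M.Tup (joinSrt y z) :=
  fun i => c.append d (finSumFinEquiv.symm i)

lemma Str.Tup.cast_apply {V : Type v} {x : V → σ.Srt} (a : M.Tup x) {i j : V} (h : i = j) :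
    (congrArg x h ▸ a i : M.carrier (x j)) = a j := by
  subst h; rfl

namespace PForm

variable {n k l : ℕ} {x : Fin n → σ.Srt} {y : Fin k → σ.Srt} {z : Fin l → σ.Srt}

/-- The inclusion of the variables `x, y` into `x, y, z`. -/
def varLeft (x : Fin n → σ.Srt) (y : Fin k → σ.Srt) (z : Fin l → σ.Srt) :
    ∀ i, Term σ (Sum.elim x (joinSrt y z)) (Sum.elim x y i)
  | .inl i => .var (x := Sum.elim x (joinSrt y z)) (.inl i)
  | .inr j => .varOfEq (x := Sum.elim x (joinSrt y z)) (.inr (finSumFinEquiv (.inl j)))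
      (congrArg (Sum.elim y z) (finSumFinEquiv.symm_apply_apply (.inl j)))

/-- The inclusion of the variables `x, z` into `x, y, z`. -/
def varRight (x : Fin n → σ.Srt) (y : Fin k → σ.Srt) (z : Fin l → σ.Srt) :
    ∀ i, Term σ (Sum.elim x (joinSrt y z)) (Sum.elim x z i)
  | .inl i => .var (x := Sum.elim x (joinSrt y z)) (.inl i)
  | .inr j => .varOfEq (x := Sum.elim x (joinSrt y z)) (.inr (finSumFinEquiv (.inr j)))
      (congrArg (Sum.elim y z) (finSumFinEquiv.symm_apply_apply (.inr j)))

/-- The negation of a partitioned formula. -/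
def neg (ψ : PForm σ x y) : PForm σ x y :=
  BForm.imp ψ .falsum

/-- The disjunction of two partitioned formulas with disjoint tuples of parameter variables. -/
def disj (ψ : PForm σ x y) (θ : PForm σ x z) : PForm σ x (joinSrt y z) :=
  BForm.imp (BForm.imp (BForm.subst (varLeft x y z) ψ) .falsum) (BForm.subst (varRight x y z) θ)

lemma points_falsum (c : M.Tup y) : PForm.points (BForm.falsum : PForm σ x y) c = ∅ := by
  ext a
  exact Iff.rfl

lemma points_neg (ψ : PForm σ x y) (c : M.Tup y) : ψ.neg.points c = (ψ.points c)ᶜ := by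
  ext a
  exact Iff.rfl

lemma points_disj (ψ : PForm σ x y) (θ : PForm σ x z) (c : M.Tup y) (d : M.Tup z) :
    (ψ.disj θ).points (c.join d) = ψ.points c ∪ θ.points d := by
  ext a
  have h₁ : (fun i => (varLeft x y z i).eval (a.append (c.join d))) = a.append c := by
    funext i
    rcases i with i | j
    · rfl
    · exact (Term.eval_varOfEq _ _ _).trans
        (Str.Tup.cast_apply (c.append d) (finSumFinEquiv.symm_apply_apply (.inl j)))
  have h₂ : (fun i => (varRight x y z i).eval (a.append (c.join d))) = a.append d := by
    funext i
    rcases i with i | j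
    · rfl
    · exact (Term.eval_varOfEq _ _ _).trans
        (Str.Tup.cast_apply (c.append d) (finSumFinEquiv.symm_apply_apply (.inr j)))
  simp only [points, Form.Sat, disj, BForm.Holds, BForm.holds_subst, h₁, h₂, Set.mem_ofPred_eq,
    Set.mem_union]
  tauto

end PForm

section Definable

variable {n m : ℕ} {x : Fin n → σ.Srt} {y : Fin m → σ.Srt}

lemma points_mem_definableSets (ψ : PForm σ x y) (c : M.Tup y) :
    ψ.points c ∈ M.definableSets x :=
  ⟨m, y, ψ, c, rfl⟩

lemma compl_mem_definableSets {D : Set (M.Tup x)} (hD : D ∈ M.definableSets x) :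
    Dᶜ ∈ M.definableSets x := by
  obtain ⟨k, y, ψ, c, rfl⟩ := hD
  exact ⟨k, y, ψ.neg, c, (ψ.points_neg c).symm⟩

lemma union_mem_definableSets {D E : Set (M.Tup x)} (hD : D ∈ M.definableSets x)
    (hE : E ∈ M.definableSets x) : D ∪ E ∈ M.definableSets x := by
  obtain ⟨k, y, ψ, c, rfl⟩ := hD
  obtain ⟨l, z, θ, d, rfl⟩ := hE
  exact ⟨_, _, ψ.disj θ, c.join d, (ψ.points_disj θ c d).symm⟩

lemma inter_mem_definableSets {D E : Set (M.Tup x)} (hD : D ∈ M.definableSets x)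
    (hE : E ∈ M.definableSets x) : D ∩ E ∈ M.definableSets x := by
  rw [← compl_compl (D ∩ E), Set.compl_inter]
  exact compl_mem_definableSets
    (union_mem_definableSets (compl_mem_definableSets hD) (compl_mem_definableSets hE))

lemma empty_mem_definableSets : ∅ ∈ M.definableSets x :=
  ⟨0, fun i => i.elim0, .falsum, fun i => i.elim0, (PForm.points_falsum _).symm⟩

lemma univ_mem_definableSets : Set.univ ∈ M.definableSets x := by
  rw [← Set.compl_empty]
  exact compl_mem_definableSets empty_mem_definableSets

lemma points_mem_localAlgebra (φ : PForm σ x y) {B : Set (Σ s, M.carrier s)} {c : M.Tup y}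
    (hc : ∀ k, ⟨y k, c k⟩ ∈ B) : φ.points c ∈ localAlgebra φ B :=
  BooleanSubalgebra.subset_closure ⟨c, hc, rfl⟩

end Definable

/-! ### Ultrapowers -/

open Filter

section Ultrapower

variable (U : Ultrafilter ℕ)

/-- The ultrapower of `M` with respect to an ultrafilter on `ℕ`. -/
noncomputable def Str.ultrapower (M : Str σ) (U : Ultrafilter ℕ) : Str σ where
  carrier s := Germ (U : Filter ℕ) (M.carrier s)
  fn f ts := ((fun n => M.fn f fun i => Quotient.out (ts i) n : ℕ → M.carrier _) :
    Germ (U : Filter ℕ) _)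
  rl R ts := ∀ᶠ n in U, M.rl R fun i => Quotient.out (ts i) n

/-- The element of the ultrapower given by a sequence of elements. -/
def Str.ultraMk {s : σ.Srt} (g : ℕ → M.carrier s) : (M.ultrapower U).carrier s :=
  (g : Germ (U : Filter ℕ) (M.carrier s))

/-- The tuple in the ultrapower given by a sequence of tuples. -/
def Str.Tup.ultra {V : Type v} {x : V → σ.Srt} (a : ℕ → M.Tup x) : (M.ultrapower U).Tup x :=
  fun i => Str.ultraMk U fun n => a n i

lemma Str.ultraMk_surjective {s : σ.Srt} (d : (M.ultrapower U).carrier s) :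
    ∃ g : ℕ → M.carrier s, Str.ultraMk U g = d :=
  Quotient.exists_rep d

lemma Str.ultraMk_eq {s : σ.Srt} {g h : ℕ → M.carrier s} :
    Str.ultraMk U g = Str.ultraMk U h ↔ ∀ᶠ n in U, g n = h n :=
  Germ.coe_eq

/-- Makes the symbols of the ultrapower, defined through chosen representatives, computable on any
representatives. -/
lemma Str.eventually_out_ultraMk {s : σ.Srt} (g : ℕ → M.carrier s) :
    ∀ᶠ n in U, Quotient.out (Str.ultraMk U g : Germ (U : Filter ℕ) (M.carrier s)) n = g n :=
  Germ.coe_eq.1 (Quotient.out_eq (Str.ultraMk U g : Germ (U : Filter ℕ) (M.carrier s)))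

lemma Term.eval_ultra {V : Type v} {x : V → σ.Srt} (a : ℕ → M.Tup x) {s : σ.Srt}
    (t : Term σ x s) :
    t.eval (Str.Tup.ultra U a) = Str.ultraMk U fun n => t.eval (a n) := by
  induction t with
  | var i => rfl
  | app f ts ih =>
    simp only [Term.eval, ih]
    refine (Str.ultraMk_eq U).2 ?_
    filter_upwards [eventually_all.2 fun i =>
      Str.eventually_out_ultraMk U fun n => (ts i).eval (a n)] with n hn
    exact congrArg _ (funext hn)

lemma Str.Tup.ultra_env {V : Type v} {x : V → σ.Srt} {Γ : List σ.Srt} (a : ℕ → M.Tup x)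
    (e : ℕ → M.Tup Γ.get) :
    (Str.Tup.ultra U a).env (Str.Tup.ultra U e) = Str.Tup.ultra U fun n => (a n).env (e n) := by
  funext i
  rcases i with i | j <;> rfl

lemma Str.Tup.ultra_append {V W : Type v} {x : V → σ.Srt} {z : W → σ.Srt} (a : ℕ → M.Tup x)
    (c : ℕ → M.Tup z) :
    (Str.Tup.ultra U a).append (Str.Tup.ultra U c) =
      Str.Tup.ultra U fun n => (a n).append (c n) := by
  funext i
  rcases i with i | j <;> rfl

lemma Str.Tup.ultra_join {k l : ℕ} {y : Fin k → σ.Srt} {z : Fin l → σ.Srt} (c : ℕ → M.Tup y)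
    (d : ℕ → M.Tup z) :
    (Str.Tup.ultra U c).join (Str.Tup.ultra U d) = Str.Tup.ultra U fun n => (c n).join (d n) := by
  funext i
  exact congrFun (Str.Tup.ultra_append U c d) _

lemma Str.Tup.ultra_cons {s : σ.Srt} {Γ : List σ.Srt} (g : ℕ → M.carrier s)
    (e : ℕ → M.Tup Γ.get) :
    Str.Tup.cons (Str.ultraMk U g) (Str.Tup.ultra U e) =
      Str.Tup.ultra U fun n => Str.Tup.cons (g n) (e n) := by
  funext i
  rcases i with ⟨_ | i, hi⟩ <;> rfl

/-- Łoś's theorem. -/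
lemma BForm.holds_ultra {V : Type v} {x : V → σ.Srt} (a : ℕ → M.Tup x) {Γ : List σ.Srt}
    (φ : BForm σ x Γ) (e : ℕ → M.Tup Γ.get) :
    φ.Holds (Str.Tup.ultra U a) (Str.Tup.ultra U e) ↔ ∀ᶠ n in U, φ.Holds (a n) (e n) := by
  induction φ with
  | falsum => simpa [BForm.Holds] using U.neBot.ne
  | eq t₁ t₂ =>
    simp only [BForm.Holds, Str.Tup.ultra_env, Term.eval_ultra, Str.ultraMk_eq]
  | rel R ts =>
    simp only [BForm.Holds, Str.Tup.ultra_env, Term.eval_ultra]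
    refine eventually_congr ?_
    filter_upwards [eventually_all.2 fun i =>
      Str.eventually_out_ultraMk U fun n => (ts i).eval ((a n).env (e n))] with n hn
    exact iff_of_eq (congrArg _ (funext hn))
  | imp φ ψ ih₁ ih₂ =>
    simp only [BForm.Holds, ih₁, ih₂]
    exact Ultrafilter.eventually_imp.symm
  | all s φ ih =>
    simp only [BForm.Holds]
    constructor
    · intro h
      by_contra hn
      rw [← Ultrafilter.eventually_not] at hn
      -- Sorts may be empty; a counterexample at one index supplies the default value `d₀` for the
      -- sequence of witnesses.
      obtain ⟨n₀, hn₀⟩ := hn.exists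
      push Not at hn₀
      obtain ⟨d₀, -⟩ := hn₀
      have hg : ∀ n, ∃ d : M.carrier s, (¬ ∀ d, φ.Holds (a n) (Str.Tup.cons d (e n))) →
          ¬ φ.Holds (a n) (Str.Tup.cons d (e n)) := by
        intro n
        by_cases hd : ∀ d, φ.Holds (a n) (Str.Tup.cons d (e n))
        · exact ⟨d₀, fun h => absurd hd h⟩
        · obtain ⟨d, hd⟩ := not_forall.1 hd
          exact ⟨d, fun _ => hd⟩
      choose g hg using hg
      have := h (Str.ultraMk U g)
      rw [Str.Tup.ultra_cons, ih] at this
      obtain ⟨n, h₁, h₂⟩ := (this.and hn).exists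
      exact hg n h₂ h₁
    · intro h d
      obtain ⟨g, rfl⟩ := Str.ultraMk_surjective U d
      rw [Str.Tup.ultra_cons, ih]
      exact h.mono fun n hn => hn _

lemma Form.sat_ultra {V : Type v} {x : V → σ.Srt} (a : ℕ → M.Tup x) (φ : Form σ x) :
    Form.Sat φ (Str.Tup.ultra U a) ↔ ∀ᶠ n in U, Form.Sat φ (a n) := by
  refine Iff.trans (iff_of_eq ?_) (BForm.holds_ultra U a φ fun _ i => i.elim0)
  exact congrArg (BForm.Holds _ φ) (funext fun i => i.elim0)

lemma Str.IsModel.ultrapower {T : Set (Sentence σ)} (hM : M.IsModel T) :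
    (M.ultrapower U).IsModel T := by
  intro θ hθ
  have := (Form.sat_ultra U (fun _ e => e.elim) θ).2 (Eventually.of_forall fun _ => hM θ hθ)
  convert this using 1

lemma mem_points_ultra {n m : ℕ} {x : Fin n → σ.Srt} {y : Fin m → σ.Srt} (ψ : PForm σ x y)
    (a : ℕ → M.Tup x) (c : ℕ → M.Tup y) :
    Str.Tup.ultra U a ∈ ψ.points (Str.Tup.ultra U c) ↔ ∀ᶠ n in U, a n ∈ ψ.points (c n) := by
  simp only [PForm.points, Set.mem_ofPred_eq, Str.Tup.ultra_append, Form.sat_ultra]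

end Ultrapower

/-! ### Wide elements -/

section Wide

variable {n m : ℕ} {x : Fin n → σ.Srt} {y : Fin m → σ.Srt}

lemma finite_setOf_params (y : Fin m → σ.Srt) {F : Set (Σ s, M.carrier s)} (hF : F.Finite) :
    {c : M.Tup y | ∀ k, ⟨y k, c k⟩ ∈ F}.Finite := by
  have := Set.Finite.preimage (f := fun (c : M.Tup y) (k : Fin m) =>
    (⟨y k, c k⟩ : Σ s, M.carrier s)) (s := Set.univ.pi fun _ => F) ?_ (Set.Finite.pi fun _ => hF)
  · refine this.subset fun c hc => ?_
    simpa using hc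
  · intro c _ d _ h
    funext k
    simpa using congrFun h k

/-- A definable set outside an ideal can be refined to one that decides finitely many definable
sets. -/
lemma Str.IsIdeal.exists_deciding {J : Set (Set (M.Tup x))} (hJ : M.IsIdeal J)
    {G : Set (Set (M.Tup x))} (hG : G.Finite) (hGdef : G ⊆ M.definableSets x)
    {D : Set (M.Tup x)} (hD : D ∈ M.definableSets x) (hDJ : D ∉ J) :
    ∃ D' ⊆ D, D' ∈ M.definableSets x ∧ D' ∉ J ∧ ∀ E ∈ G, D' ⊆ E ∨ D' ⊆ Eᶜ := by
  induction G, hG using Set.Finite.induction_on with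
  | empty => exact ⟨D, subset_rfl, hD, hDJ, by simp⟩
  | @insert E G _ _ ih =>
    obtain ⟨D', hD'D, hD', hD'J, hdec⟩ := ih ((Set.subset_insert _ _).trans hGdef)
    have hE := hGdef (Set.mem_insert E G)
    have key : D' ∩ E ∉ J ∨ D' ∩ Eᶜ ∉ J := by
      by_contra! h
      exact hD'J (Set.inter_union_compl D' E ▸ hJ.sup_mem _ h.1 _ h.2)
    rcases key with h | h
    · refine ⟨_, Set.inter_subset_left.trans hD'D, inter_mem_definableSets hD' hE, h, ?_⟩
      rintro E' (rfl | hE')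
      · exact .inl Set.inter_subset_right
      · exact (hdec E' hE').imp Set.inter_subset_left.trans Set.inter_subset_left.trans
    · refine ⟨_, Set.inter_subset_left.trans hD'D,
        inter_mem_definableSets hD' (compl_mem_definableSets hE), h, ?_⟩
      rintro E' (rfl | hE')
      · exact .inr Set.inter_subset_right
      · exact (hdec E' hE').imp Set.inter_subset_left.trans Set.inter_subset_left.trans

/-- Every definable set outside an ideal has an element whose local type over a given finite set is
wide. -/
lemma Str.IsIdeal.exists_isWide {J : Set (Set (M.Tup x))} (hJ : M.IsIdeal J) (φ : PForm σ x y)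
    {F : Set (Σ s, M.carrier s)} (hF : F.Finite)
    {D : Set (M.Tup x)} (hD : D ∈ M.definableSets x) (hDJ : D ∉ J) :
    ∃ a ∈ D, IsWide J (localType φ a F) := by
  obtain ⟨D', hD'D, hD', hD'J, hdec⟩ := hJ.exists_deciding
    (G := φ.points '' {c : M.Tup y | ∀ k, ⟨y k, c k⟩ ∈ F}) ((finite_setOf_params y hF).image _)
    (by rintro _ ⟨c, -, rfl⟩; exact points_mem_definableSets φ c) hD hDJ
  -- The sets decided by `D'` are closed under Boolean operations, so deciding the generators
  -- suffices.
  have hdec' : ∀ E ∈ localAlgebra φ F, D' ⊆ E ∨ D' ⊆ Eᶜ := by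
    intro E hE
    induction hE using BooleanSubalgebra.closure_bot_sup_induction with
    | mem E hE =>
      obtain ⟨c, hc, rfl⟩ := hE
      exact hdec _ ⟨c, hc, rfl⟩
    | bot => exact .inr (by simp)
    | sup E₁ _ E₂ _ h₁ h₂ =>
      rcases h₁ with h₁ | h₁
      · exact .inl (h₁.trans Set.subset_union_left)
      rcases h₂ with h₂ | h₂
      · exact .inl (h₂.trans Set.subset_union_right)
      · exact .inr ((Set.subset_inter h₁ h₂).trans (Set.compl_union _ _).superset)
    | compl E _ h => exact h.symm.imp id fun h => h.trans (compl_compl E).superset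
  obtain ⟨a, ha⟩ : D'.Nonempty := by
    rw [Set.nonempty_iff_ne_empty]
    rintro rfl
    exact hD'J hJ.bot_mem
  refine ⟨a, hD'D ha, Set.eq_empty_of_forall_notMem ?_⟩
  rintro E ⟨⟨hE, haE⟩, hEJ⟩
  rcases hdec' E hE with h | h
  · exact hD'J (hJ.down E hEJ D' hD' h)
  · exact h ha haE

/-- A lower bound on the rank gives trees whose leaves are wide over any sufficiently large finite
set of parameters. -/
lemma RankGE.exists_hasTree {J : Set (Set (M.Tup x))} (hJ : M.IsIdeal J) {φ : PForm σ x y}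
    {k : ℕ} {D : Set (M.Tup x)} (hD : D ∈ M.definableSets x) (h : RankGE J φ k D) :
    ∃ F₀ : Set (Σ s, M.carrier s), F₀.Finite ∧ ∀ F, F₀ ⊆ F → F.Finite →
      HasTree (fun a c => a ∈ φ.points c) {c : M.Tup y | ∀ k, ⟨y k, c k⟩ ∈ F} k
        (D ∩ {a | IsWide J (localType φ a F)}) := by
  induction k generalizing D with
  | zero =>
    refine ⟨∅, Set.finite_empty, fun F _ hF => ?_⟩
    exact hJ.exists_isWide φ hF hD h
  | succ k ih =>
    obtain ⟨c, h₁, h₂⟩ := h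
    have hc := points_mem_definableSets φ c
    obtain ⟨F₁, hF₁, h₁⟩ := ih (inter_mem_definableSets hD hc) h₁
    obtain ⟨F₂, hF₂, h₂⟩ :=
      ih (inter_mem_definableSets hD (compl_mem_definableSets hc)) h₂
    -- Both subtrees must be wide over one common `F`, which is why the induction allows every
    -- finite `F ⊇ F₀`.
    refine ⟨F₁ ∪ F₂ ∪ Set.range fun k => ⟨y k, c k⟩,
      (hF₁.union hF₂).union (Set.finite_range _), fun F hF hFfin => ?_⟩
    refine ⟨c, fun k => hF (.inr ⟨k, rfl⟩), ?_, ?_⟩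
    · refine (h₁ F (fun e he => hF (.inl (.inl he))) hFfin).mono subset_rfl ?_
      rintro a ⟨⟨ha, hac⟩, haw⟩
      exact ⟨⟨ha, haw⟩, hac⟩
    · refine (h₂ F (fun e he => hF (.inl (.inr he))) hFfin).mono subset_rfl ?_
      rintro a ⟨⟨ha, hac⟩, haw⟩
      exact ⟨⟨ha, haw⟩, hac⟩

end Wide

/-! ### The rank -/

section Rank

variable {n m : ℕ} {x : Fin n → σ.Srt} {y : Fin m → σ.Srt}

/-- If the attained `k` are unbounded, the supremum exceeds every natural number, which only `⊤`
does. -/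
lemma rank_lt_top_iff (J : Set (Set (M.Tup x))) (φ : PForm σ x y) (D : Set (M.Tup x)) :
    rank J φ D < ⊤ ↔ ∃ N : ℕ, ∀ k, RankGE J φ k D → k ≤ N := by
  constructor
  · intro h
    by_contra! hN
    have key : ∀ N : ℕ, ((N : ℕ∞) : WithBot ℕ∞) < rank J φ D := by
      intro N
      obtain ⟨k, hk, hNk⟩ := hN N
      refine lt_of_lt_of_le ?_ (le_sSup ⟨k, hk, rfl⟩)
      exact_mod_cast hNk
    generalize rank J φ D = r at h key
    induction r using WithBot.recBotCoe with
    | bot => exact not_lt_bot (key 0)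
    | coe r =>
      induction r using ENat.recTopCoe with
      | top => exact lt_irrefl _ h
      | coe r => exact lt_irrefl _ (key r)
  · rintro ⟨N, hN⟩
    have : rank J φ D ≤ ((N : ℕ∞) : WithBot ℕ∞) := by
      refine sSup_le ?_
      rintro _ ⟨k, hk, rfl⟩
      exact_mod_cast hN k hk
    refine this.trans_lt ?_
    exact WithBot.coe_lt_coe.2 (ENat.natCast_lt_top N)

/-- A ladder of length `2 ^ k` of wide elements of `D` bounds the rank of `D` from below. -/
lemma rankGE_of_ladder {J : Set (Set (M.Tup x))} {φ : PForm σ x y} {a : ℕ → M.Tup x}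
    {b : ℕ → M.Tup y} (hab : ∀ i j : ℕ, a i ∈ φ.points (b j) ↔ i < j)
    (hw : ∀ i, IsWide J (localType φ (a i) (paramSet b))) (k s : ℕ) {D : Set (M.Tup x)}
    (hD : D ∈ localAlgebra φ (paramSet b)) (haD : ∀ i, s ≤ i → i < s + 2 ^ k → a i ∈ D) :
    RankGE J φ k D := by
  induction k generalizing s D with
  | zero =>
    intro hDJ
    exact (hw s).subset ⟨⟨hD, haD s le_rfl (by simp)⟩, hDJ⟩
  | succ k ih =>
    have hb : φ.points (b (s + 2 ^ k)) ∈ localAlgebra φ (paramSet b) :=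
      points_mem_localAlgebra φ fun l => ⟨s + 2 ^ k, l, rfl⟩
    rw [pow_succ] at haD
    refine ⟨b (s + 2 ^ k), ih s (BooleanSubalgebra.infClosed _ hD hb) ?_,
      ih (s + 2 ^ k)
        (BooleanSubalgebra.infClosed _ hD (BooleanSubalgebra.compl_mem hb)) ?_⟩
    · exact fun i h₁ h₂ => ⟨haD i h₁ (by omega), (hab _ _).2 h₂⟩
    · exact fun i h₁ h₂ => ⟨haD i (by omega) (by omega), fun h => by
        have := (hab _ _).1 h
        omega⟩

end Rank

/-! ### Wide orders in ultrapowers -/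

section WideOrder

variable {n m : ℕ} {x : Fin n → σ.Srt} {y : Fin m → σ.Srt}

/-- Every set in the local algebra of an ultrapower is an ultraproduct of sets in the local
algebras. -/
lemma exists_points_of_mem_localAlgebra_ultra (U : Ultrafilter ℕ) (φ : PForm σ x y)
    {F : ℕ → Set (Σ s, M.carrier s)} {B : Set (Σ s, (M.ultrapower U).carrier s)}
    (hB : ∀ s d, ⟨s, d⟩ ∈ B → ∃ g : ℕ → M.carrier s, Str.ultraMk U g = d ∧ ∀ n, ⟨s, g n⟩ ∈ F n)
    {D : Set ((M.ultrapower U).Tup x)} (hD : D ∈ localAlgebra φ B) :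
    ∃ (l : ℕ) (z : Fin l → σ.Srt) (ψ : PForm σ x z) (c : ℕ → M.Tup z),
      D = ψ.points (Str.Tup.ultra U c) ∧ ∀ n, ψ.points (c n) ∈ localAlgebra φ (F n) := by
  -- A single formula `ψ` serves all `n`, only its parameters vary; this uniformity is what Łoś
  -- needs.
  induction hD using BooleanSubalgebra.closure_bot_sup_induction with
  | mem D hD =>
    obtain ⟨c, hc, rfl⟩ := hD
    choose g hg hgF using fun k => hB (y k) (c k) (hc k)
    refine ⟨m, y, φ, fun n k => g k n, ?_, fun n => points_mem_localAlgebra φ fun k => hgF k n⟩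
    congr 1
    funext k
    exact (hg k).symm
  | bot =>
    refine ⟨0, fun i => i.elim0, .falsum, fun _ i => i.elim0, (PForm.points_falsum _).symm,
      fun n => ?_⟩
    rw [PForm.points_falsum]
    exact BooleanSubalgebra.bot_mem
  | sup D _ E _ hD hE =>
    obtain ⟨k, z, ψ, c, rfl, hc⟩ := hD
    obtain ⟨l, w, θ, d, rfl, hd⟩ := hE
    refine ⟨_, _, ψ.disj θ, fun n => (c n).join (d n), ?_, fun n => ?_⟩
    · rw [← Str.Tup.ultra_join, PForm.points_disj]
      rfl
    · rw [PForm.points_disj]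
      exact BooleanSubalgebra.supClosed _ (hc n) (hd n)
  | compl D _ hD =>
    obtain ⟨k, z, ψ, c, rfl, hc⟩ := hD
    refine ⟨_, _, ψ.neg, c, (PForm.points_neg _ _).symm, fun n => ?_⟩
    rw [PForm.points_neg]
    exact BooleanSubalgebra.compl_mem (hc n)

/-- An ultraproduct of tuples that are wide over `F n` is wide over the ultraproduct of the sets
`F n`. -/
lemma isWide_ultra (U : Ultrafilter ℕ) {I : Preschema x}
    (hI : Preschema.IsInvariant I (M.ultrapower U)) (φ : PForm σ x y)
    {F : ℕ → Set (Σ s, M.carrier s)} {B : Set (Σ s, (M.ultrapower U).carrier s)}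
    (hB : ∀ s d, ⟨s, d⟩ ∈ B → ∃ g : ℕ → M.carrier s, Str.ultraMk U g = d ∧ ∀ n, ⟨s, g n⟩ ∈ F n)
    {a : ℕ → M.Tup x} (ha : ∀ n, IsWide (Preschema.points I M) (localType φ (a n) (F n))) :
    IsWide (Preschema.points I (M.ultrapower U)) (localType φ (Str.Tup.ultra U a) B) := by
  refine Set.eq_empty_of_forall_notMem ?_
  rintro D ⟨⟨hD, haD⟩, l', z', ψ', c', hD', hwide⟩
  obtain ⟨l, z, ψ, c, rfl, hc⟩ := exists_points_of_mem_localAlgebra_ultra U φ hB hD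
  -- Invariance replaces the arbitrary definition `ψ'` of the set by the uniform `ψ`.
  rw [← hI ψ ψ' _ _ hD'] at hwide
  refine hwide fun θ hθ => (Form.sat_ultra U c θ).2 ?_
  -- For almost all `n`, `ψ.points (c n)` belongs to the wide type of `a n`, so `c n` satisfies
  -- every `θ`.
  filter_upwards [(mem_points_ultra U ψ a c).1 haD] with n hn
  by_contra hθn
  exact (ha n).subset ⟨⟨hc n, hn⟩, l, z, ψ, c n, rfl, fun h => hθn (h θ hθ)⟩

/-- If the rank is unbounded in `M`, then an ultrapower of `M` realizes an infinite wide order. -/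
lemma realizesWideOrder_ultrapower {I : Preschema x} {φ : PForm σ x y}
    (hJ : M.IsIdeal (Preschema.points I M))
    (hI : Preschema.IsInvariant I (M.ultrapower (hyperfilter ℕ)))
    (h : ∀ N, ∃ k ≥ N, RankGE (Preschema.points I M) φ k Set.univ) :
    RealizesWideOrder (M.ultrapower (hyperfilter ℕ)) I φ := by
  have ladder : ∀ N : ℕ, ∃ (F : Set (Σ s, M.carrier s)) (a : ℕ → M.Tup x) (b : ℕ → M.Tup y),
      (∀ i, IsWide (Preschema.points I M) (localType φ (a i) F)) ∧
      (∀ j k, ⟨y k, b j k⟩ ∈ F) ∧ ∀ i < N, ∀ j < N, a i ∈ φ.points (b j) ↔ i < j := by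
    intro N
    obtain ⟨k₀, hk₀⟩ :=
      HasTree.exists_halfGraph (fun (a : M.Tup x) (c : M.Tup y) => a ∈ φ.points c) N
    obtain ⟨k, hk, hrank⟩ := h k₀
    obtain ⟨F, hF, htree⟩ := hrank.exists_hasTree hJ univ_mem_definableSets
    obtain ⟨a, b, ha, hb, hab⟩ := hk₀ _ _ ((htree F subset_rfl hF).of_le hk)
    exact ⟨F, a, b, fun i => (ha i).2, hb, hab⟩
  choose F a b ha hb hab using ladder
  refine ⟨fun i => Str.Tup.ultra _ fun N => a N i, fun j => Str.Tup.ultra _ fun N => b N j,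
    fun i j => ?_, fun i => isWide_ultra _ hI φ (F := F) ?_ fun N => ha N i⟩
  · have hev : ∀ᶠ N in (hyperfilter ℕ : Filter ℕ), i < N ∧ j < N :=
      Nat.hyperfilter_le_atTop ((eventually_gt_atTop i).and (eventually_gt_atTop j))
    refine (mem_points_ultra (hyperfilter ℕ) φ (fun N => a N i) fun N => b N j).trans ?_
    constructor
    · intro h'
      obtain ⟨N, h₁, h₂, h₃⟩ := (h'.and hev).exists
      exact (hab N i h₂ j h₃).1 h₁
    · intro hij
      filter_upwards [hev] with N hN
      exact (hab N i hN.1 j hN.2).2 hij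
  · rintro s d ⟨j, k, hjk⟩
    obtain ⟨rfl, hd⟩ := Sigma.mk.inj hjk
    obtain rfl := eq_of_heq hd
    exact ⟨fun N => b N j k, rfl, fun N => hb N j k⟩

end WideOrder

end WideStability

theorem mainTheorem2 {σ : WideStability.Signature.{u}} (T : Set (WideStability.Sentence σ))
    (hT : WideStability.IsCompleteTheory T) {n m : ℕ} (x : Fin n → σ.Srt) (y : Fin m → σ.Srt)
    (I : WideStability.Preschema x) (hI : WideStability.Preschema.IsIdealSchema I T)
    (φ : WideStability.PForm σ x y) :
    WideStability.IsStable T I φ ↔ ¬ WideStability.HasWideOrderProperty T I φ := by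
  open WideStability in
  constructor
  · rintro hφ ⟨M, hM, a, b, hab, hw⟩
    obtain ⟨N, hN⟩ := (rank_lt_top_iff _ φ _).1 (hφ M hM)
    have := hN (N + 1) (rankGE_of_ladder hab hw (N + 1) 0 BooleanSubalgebra.top_mem
      fun _ _ _ => Set.mem_univ _)
    omega
  · intro hφ M hM
    by_contra hstable
    rw [IsStableIn, rank_lt_top_iff] at hstable
    push Not at hstable
    refine hφ ⟨_, hM.ultrapower (Filter.hyperfilter ℕ), realizesWideOrder_ultrapower (hI M hM).2
      (hI _ (hM.ultrapower _)).1 fun N => ?_⟩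
    obtain ⟨k, hk, hNk⟩ := hstable N
    exact ⟨k, hNk.le, hk⟩
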